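/- **Conventions.** A globular set $X$ consists of sets $X_n$ ($n\ge 0$) and maps $\mathrm{src},\mathrm{tgt}:X_{n+1}\to X_n$ with $\mathrm{src}\,\mathrm{src}=\mathrm{src}\,\mathrm{tgt}$ and $\mathrm{tgt}\,\mathrm{tgt}=\mathrm{tgt}\,\mathrm{src}$; equivalently, a presheaf on the category $\mathbb G$ with objects $[n]$ generated by $s,t:[n]\to[n+1]$ under the dual relations. $\mathsf{Glob}$ is the category of globular sets. The category of elements $\mathrm{el}\,X$ has as objects the pairs $([n],x)$ with $x\in X_n$, and its morphisms $([m],x)\to([n],y)$ are the $f:[m]\to[n]$ in $\mathbb G$ with $X(f)(y)=x$. A Batanin tree is a finite list $B=\mathrm{br}[B_1,\dots,B_k]$ of Batanin trees, and $\dim B$ is its height. Its globular set of positions $\mathrm{Pos}(B)$ has the positions: $\mathrm{obpos}\in\mathrm{Pos}_0(B)$ for every $B$; $\mathrm{inr}\,p\in \mathrm{Pos}_n(\mathrm{br}[B,L])$ for $p\in\mathrm{Pos}_n(\mathrm{br}\,L)$; $\mathrm{inl}\,q\in \mathrm{Pos}_{n+1}(\mathrm{br}[B,L])$ for $q\in\mathrm{Pos}_n(B)$.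 The source and target commute with $\mathrm{inr}$, and with $\mathrm{inl}$ on positions of positive dimension; for $q$ of dimension $0$, $\mathrm{src}(\mathrm{inl}\,q)=\mathrm{obpos}$ and $\mathrm{tgt}(\mathrm{inl}\,q)=\mathrm{inr}(\mathrm{obpos})$. A position is source boundary if it is not the target of a position, and target boundary if it is not the source of one; $\partial^s_nB$ and $\partial^t_nB$ are the sets of such $n$-positions. **Computads.** The categories $\mathsf{Comp}_n$ of $n$-computads, with functors $\mathrm{Cell}_n,\mathrm{Sph}_n:\mathsf{Comp}_n\to\mathsf{Set}$ (cells and spheres) and computads $\mathrm{Free}_nX$ for $X\in\mathsf{Glob}$, are defined by recursion on $n$. * $\mathsf{Comp}_0=\mathsf{Set}$, $\mathrm{Cell}_0(C)=C$, $\mathrm{Sph}_0(C)=C\times C$, $\mathrm{Free}_0X=X_0$. The $0$-sphere of $\mathrm{Free}_0X$ given by a pair $(a,b)$ is $(a,b)$. A $0$-sphere $(a,b)$ of $\mathrm{Free}_0\mathrm{Pos}(B)$ is full if $a\in\partial^s_0B$ and $b\in\partial^t_0B$. * For $n\ge 1$, an $n$-computad is a triple $C=(C_{n-1},V_n^C,\phi_n^C)$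 with $C_{n-1}\in\mathsf{Comp}_{n-1}$, $V^C_n$ a set (of generators) and $\phi_n^C:V_n^C\to\mathrm{Sph}_{n-1}(C_{n-1})$. The free computad $\mathrm{Free}_nX$ is $(\mathrm{Free}_{n-1}X,X_n,\phi)$, where $\phi(x)$ is the sphere given by the pair $(\mathrm{src}\,x,\mathrm{tgt}\,x)$. The cells of $C$, their boundaries $\mathrm{ty}:\mathrm{Cell}_n(C)\to\mathrm{Sph}_{n-1}(C_{n-1})$ and the homomorphisms into $C$ are defined by mutual induction. A cell is either $\mathrm{var}\,v$ with $v\in V_n^C$, with boundary $\phi_n^C(v)$, or $\mathrm{coh}(B,A,\tau)$ with $B$ a Batanin tree of dimension at most $n$, $A$ a full sphere in $\mathrm{Sph}_{n-1}(\mathrm{Free}_{n-1}\mathrm{Pos}(B))$ and $\tau:\mathrm{Free}_n\mathrm{Pos}(B)\to C$ a homomorphism, with boundary $\mathrm{Sph}_{n-1}(\tau_{n-1})(A)$. A homomorphism $\sigma:D\to C$ is a pair of a homomorphism $\sigma_{n-1}:D_{n-1}\to C_{n-1}$ and a function $\sigma_V:V_n^D\to\mathrm{Cell}_n(C)$ with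 $\mathrm{ty}\,\sigma_V=\mathrm{Sph}_{n-1}(\sigma_{n-1})\,\phi^D_n$. It acts on cells by $\mathrm{var}\,v\mapsto\sigma_V(v)$ and $\mathrm{coh}(B,A,\tau)\mapsto\mathrm{coh}(B,A,\sigma\tau)$, and composition is $\sigma\tau=(\sigma_{n-1}\tau_{n-1},\mathrm{Cell}_n(\sigma)\,\tau_V)$. An $n$-sphere of $C$ is a triple $(A,a,b)$ with $a,b\in\mathrm{Cell}_n(C)$ and $\mathrm{ty}\,a=\mathrm{ty}\,b=A$. The $n$-sphere of $\mathrm{Free}_nX$ given by a pair $(p,q)$ of $n$-cells with common source and target consists of the sphere given by $(\mathrm{src}\,p,\mathrm{tgt}\,p)$ and the cells $\mathrm{var}\,p$, $\mathrm{var}\,q$. The support of a cell is given by $\mathrm{supp}(\mathrm{var}\,v)=\{v\}$ and $\mathrm{supp}(\mathrm{coh}(B,A,\tau))=\bigcup_{p\in\mathrm{Pos}_n(B)}\mathrm{supp}(\tau_V(p))$. An $n$-sphere $(A,a,b)$ of $\mathrm{Free}_n\mathrm{Pos}(B)$ is full if $\mathrm{supp}(a)=\partial^s_nB$, $\mathrm{supp}(b)=\partial_n^tB$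 and $A$ is full. $\mathsf{Comp}$ is the limit of the categories $\mathsf{Comp}_n$ along the forgetful functors $C\mapsto C_{n-1}$. The functor $\mathrm{Cell}:\mathsf{Comp}\to\mathsf{Glob}$ sends $C$ to the globular set of the $\mathrm{Cell}_n(C_n)$, in which the source and target of $c$ are the two cells of the sphere $\mathrm{ty}\,c$. The functor $\mathrm{Sph}:\mathsf{Comp}\to\mathsf{Glob}$ sends $C$ to the globular set of the $\mathrm{Sph}_n(C_n)$, in which the source and target of $(A,a,b)$ are both $A$. A homomorphism is generator-preserving if in every dimension $n\ge1$ it sends each generator to a cell of the form $\mathrm{var}\,w$. $\mathsf{Comp}^{\mathrm{var}}\subseteq\mathsf{Comp}$ is the subcategory of all computads and generator-preserving homomorphisms, and $\mathrm{Cell}^{\mathrm{var}},\mathrm{Sph}^{\mathrm{var}}:\mathsf{Comp}^{\mathrm{var}}\to\mathsf{Glob}$ are the restrictions of $\mathrm{Cell}$ and $\mathrm{Sph}$. **Theorem.** The category $\mathsf{Comp}^{\mathrm{var}}$ has a terminal object $\top$. Put $\mathfrak C=\mathrm{Cell}^{\mathrm{var}}(\top)$ and $\mathfrak T=\mathrm{Sph}^{\mathrm{var}}(\top)$.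 The functors $\mathrm{Cell}^{\mathrm{var}}$ and $\mathrm{Sph}^{\mathrm{var}}$ are familially representable: there exist functors $$J^{\mathfrak C}:\mathrm{el}\,\mathfrak C\to\mathsf{Comp}^{\mathrm{var}},\qquad J^{\mathfrak T}:\mathrm{el}\,\mathfrak T\to\mathsf{Comp}^{\mathrm{var}}$$ and isomorphisms, natural in $C\in\mathsf{Comp}^{\mathrm{var}}$ and $[n]\in\mathbb G$, $$\mathrm{Cell}^{\mathrm{var}}_n(C)\cong\coprod_{c_0\in\mathfrak C_n}\mathsf{Comp}^{\mathrm{var}}(J^{\mathfrak C}(c_0),C),\qquad \mathrm{Sph}^{\mathrm{var}}_n(C)\cong\coprod_{A_0\in\mathfrak T_n}\mathsf{Comp}^{\mathrm{var}}(J^{\mathfrak T}(A_0),C).$$ Here a morphism $f$ of $\mathbb G$ acts on the coproducts by $(c_0,g)\mapsto(\mathfrak C(f)(c_0),\,g\circ J^{\mathfrak C}(f))$, and similarly for $\mathfrak T$. Moreover, the isomorphisms may be chosen so that the index of a cell or sphere of $C$ is its image under the unique morphism $C\to\top$ of $\mathsf{Comp}^{\mathrm{var}}$. -/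

import Mathlib

open CategoryTheory CategoryTheory.Limits

universe u

namespace OmegaComputad

/-! ### Globular sets -/

/-- A globular set: sets of `n`-cells with source and target maps satisfying globularity. -/
structure GlobularSet : Type (u + 1) where
  cells : ℕ → Type u
  src : ∀ {n : ℕ}, cells (n + 1) → cells n
  tgt : ∀ {n : ℕ}, cells (n + 1) → cells n
  src_src : ∀ {n : ℕ} (x : cells (n + 2)), src (src x) = src (tgt x)
  tgt_tgt : ∀ {n : ℕ} (x : cells (n + 2)), tgt (tgt x) = tgt (src x)

namespace GlobularSet

/-- A morphism of globular sets. -/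
@[ext]
structure Hom (X Y : GlobularSet.{u}) : Type u where
  map : ∀ n : ℕ, X.cells n → Y.cells n
  map_src : ∀ {n : ℕ} (x : X.cells (n + 1)), map n (X.src x) = Y.src (map (n + 1) x)
  map_tgt : ∀ {n : ℕ} (x : X.cells (n + 1)), map n (X.tgt x) = Y.tgt (map (n + 1) x)

instance : Category.{u} GlobularSet.{u} where
  Hom X Y := Hom X Y
  id X := ⟨fun _ x => x, fun _ => rfl, fun _ => rfl⟩
  comp f g := ⟨fun n x => g.map n (f.map n x),
    fun x => by rw [f.map_src, g.map_src], fun x => by rw [f.map_tgt, g.map_tgt]⟩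

/-- Two `n`-cells are parallel when they have common source and target
(any two `0`-cells are parallel). -/
def Parallel (X : GlobularSet.{u}) : ∀ {n : ℕ}, X.cells n → X.cells n → Prop
  | 0, _, _ => True
  | _ + 1, a, b => X.src a = X.src b ∧ X.tgt a = X.tgt b

theorem parallel_src_tgt (X : GlobularSet.{u}) :
    ∀ {n : ℕ} (x : X.cells (n + 1)), X.Parallel (X.src x) (X.tgt x)
  | 0, _ => trivial
  | _ + 1, x => ⟨X.src_src x, (X.tgt_tgt x).symm⟩

end GlobularSet

/-! ### The globe category and categories of elements -/

/-- The vertices of the quiver generating the globe category. -/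
structure GlobeQuiver : Type where
  dim : ℕ

/-- The primitive source and target inclusions `[n] → [n + 1]`. -/
inductive GlobeQuiver.Hom : GlobeQuiver → GlobeQuiver → Type
  | s (n : ℕ) : GlobeQuiver.Hom ⟨n⟩ ⟨n + 1⟩
  | t (n : ℕ) : GlobeQuiver.Hom ⟨n⟩ ⟨n + 1⟩

instance : Quiver GlobeQuiver := ⟨GlobeQuiver.Hom⟩

/-- The path consisting of the single arrow `s : [n] → [n + 1]`. -/
abbrev GlobeQuiver.sPath (n : ℕ) :
    (Paths.of GlobeQuiver).obj ⟨n⟩ ⟶ (Paths.of GlobeQuiver).obj ⟨n + 1⟩ :=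
  (Paths.of GlobeQuiver).map (GlobeQuiver.Hom.s n)

/-- The path consisting of the single arrow `t : [n] → [n + 1]`. -/
abbrev GlobeQuiver.tPath (n : ℕ) :
    (Paths.of GlobeQuiver).obj ⟨n⟩ ⟶ (Paths.of GlobeQuiver).obj ⟨n + 1⟩ :=
  (Paths.of GlobeQuiver).map (GlobeQuiver.Hom.t n)

/-- The duals of the globularity conditions. -/
inductive GlobeRel : HomRel (Paths GlobeQuiver)
  | s (n : ℕ) : GlobeRel (GlobeQuiver.sPath n ≫ GlobeQuiver.sPath (n + 1))
      (GlobeQuiver.sPath n ≫ GlobeQuiver.tPath (n + 1))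
  | t (n : ℕ) : GlobeRel (GlobeQuiver.tPath n ≫ GlobeQuiver.tPath (n + 1))
      (GlobeQuiver.tPath n ≫ GlobeQuiver.sPath (n + 1))

/-- The category `𝔾` of globes, presented by generators and relations. -/
abbrev Globe : Type := CategoryTheory.Quotient GlobeRel

namespace Globe

/-- The object `[n]`. -/
abbrev mk (n : ℕ) : Globe := (CategoryTheory.Quotient.functor GlobeRel).obj
  ((Paths.of GlobeQuiver).obj ⟨n⟩)

/-- The source inclusion `[n] ⟶ [n + 1]`. -/
def s (n : ℕ) : mk n ⟶ mk (n + 1) :=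
  (CategoryTheory.Quotient.functor GlobeRel).map (GlobeQuiver.sPath n)

/-- The target inclusion `[n] ⟶ [n + 1]`. -/
def t (n : ℕ) : mk n ⟶ mk (n + 1) :=
  (CategoryTheory.Quotient.functor GlobeRel).map (GlobeQuiver.tPath n)

theorem s_comp_s (n : ℕ) : s n ≫ s (n + 1) = s n ≫ t (n + 1) :=
  CategoryTheory.Quotient.sound GlobeRel (GlobeRel.s n)

theorem t_comp_t (n : ℕ) : t n ≫ t (n + 1) = t n ≫ s (n + 1) :=
  CategoryTheory.Quotient.sound GlobeRel (GlobeRel.t n)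

end Globe

namespace GlobularSet

variable (X : GlobularSet.{u})

/-- The action of a globular set on the generating arrows of `𝔾`. -/
def prefunctor : GlobeQuiver ⥤q (Type u)ᵒᵖ where
  obj n := Opposite.op (X.cells n.dim)
  map {_ _} f := match f with
    | .s _ => Quiver.Hom.op (TypeCat.ofHom fun x => X.src x)
    | .t _ => Quiver.Hom.op (TypeCat.ofHom fun x => X.tgt x)

/-- The presheaf on `𝔾` corresponding to a globular set. -/
def presheaf : Globeᵒᵖ ⥤ Type u :=
  (CategoryTheory.Quotient.lift GlobeRel (Paths.lift X.prefunctor) (by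
    intro _ _ _ _ h
    induction h with
    | s n =>
      apply Quiver.Hom.unop_inj
      ext x
      exact X.src_src x
    | t n =>
      apply Quiver.Hom.unop_inj
      ext x
      exact X.tgt_tgt x)).leftOp

theorem presheaf_map_s {n : ℕ} (x : X.cells (n + 1)) :
    X.presheaf.map (Globe.s n).op x = X.src x := rfl

theorem presheaf_map_t {n : ℕ} (x : X.cells (n + 1)) :
    X.presheaf.map (Globe.t n).op x = X.tgt x := rfl

/-- The category of elements of the presheaf on `𝔾` corresponding to `X`: a morphism
`(m, x) ⟶ (n, y)` is a morphism `f : [m] ⟶ [n]` of `𝔾` such that `X(f)(y) = x`. -/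
abbrev El : Type u := (X.presheaf.Elements)ᵒᵖ

variable {X}

/-- The object `(n, x)` of the category of elements. -/
abbrev El.mk {n : ℕ} (x : X.cells n) : X.El :=
  Opposite.op (X.presheaf.elementsMk (Opposite.op (Globe.mk n)) x)

/-- The morphism `(n, src x) ⟶ (n + 1, x)` over the source inclusion. -/
def El.s {n : ℕ} (x : X.cells (n + 1)) : El.mk (X.src x) ⟶ El.mk x :=
  (CategoryOfElements.homMk _ _ (Globe.s n).op (X.presheaf_map_s x)).op

/-- The morphism `(n, tgt x) ⟶ (n + 1, x)` over the target inclusion. -/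
def El.t {n : ℕ} (x : X.cells (n + 1)) : El.mk (X.tgt x) ⟶ El.mk x :=
  (CategoryOfElements.homMk _ _ (Globe.t n).op (X.presheaf_map_t x)).op

variable {D : Type*} [Category.{u} D]

theorem familial_ext (J : X.El ⥤ D) {C : D} {n : ℕ} {y y' : X.cells n} (h : y = y') {e : X.El}
    (g : El.mk y ⟶ e) (g' : El.mk y' ⟶ e) (hg : g.unop.1 = g'.unop.1) (f : J.obj e ⟶ C) :
    (⟨y, J.map g ≫ f⟩ : Σ x : X.cells n, (J.obj (El.mk x) ⟶ C)) = ⟨y', J.map g' ≫ f⟩ := by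
  subst h
  have : g = g' := Quiver.Hom.unop_inj (CategoryOfElements.ext _ _ _ hg)
  rw [this]

variable (X) in
/-- The functor familially represented by `J : el X ⥤ D`, sending `C` to the globular set
with `n`-cells `∐ (x ∈ X n), D(J x, C)`, on which `𝔾` acts by `X` on the indices and by
precomposition with the images under `J` of the morphisms of `el X`. -/
def familial (J : X.El ⥤ D) : D ⥤ GlobularSet.{u} where
  obj C :=
    { cells := fun n => Σ x : X.cells n, (J.obj (El.mk x) ⟶ C)
      src := fun p => ⟨X.src p.1, J.map (El.s p.1) ≫ p.2⟩
      tgt := fun p => ⟨X.tgt p.1, J.map (El.t p.1) ≫ p.2⟩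
      src_src := fun {n} p => by
        simp only [← Category.assoc, ← J.map_comp]
        refine familial_ext J (X.src_src p.1) _ _ ?_ p.2
        exact congrArg Quiver.Hom.op (Globe.s_comp_s n)
      tgt_tgt := fun {n} p => by
        simp only [← Category.assoc, ← J.map_comp]
        refine familial_ext J (X.tgt_tgt p.1) _ _ ?_ p.2
        exact congrArg Quiver.Hom.op (Globe.t_comp_t n) }
  map g :=
    { map := fun _ p => ⟨p.1, p.2 ≫ g⟩
      map_src := fun p => by simp
      map_tgt := fun p => by simp }
  map_id C := by
    apply GlobularSet.Hom.ext
    funext n p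
    exact Sigma.ext rfl (heq_of_eq (Category.comp_id _))
  map_comp f g := by
    apply GlobularSet.Hom.ext
    funext n p
    exact Sigma.ext rfl (heq_of_eq (Category.assoc _ _ _).symm)

end GlobularSet

/-! ### Batanin trees and their positions -/

/-- Batanin trees. -/
inductive Bat : Type
  | br : List Bat → Bat

mutual
/-- The dimension of a Batanin tree. -/
def Bat.dim : Bat → ℕ
  | .br L => Bat.dimList L
/-- The dimension of the tree `br L`. -/
def Bat.dimList : List Bat → ℕ
  | [] => 0
  | B :: L => max (Bat.dim B + 1) (Bat.dimList L)
end

/-- The `n`-dimensional positions of a Batanin tree. -/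
inductive Pos : Bat → ℕ → Type u
  | here (B : Bat) : Pos B 0
  | inr {n : ℕ} (B : Bat) (L : List Bat) (p : Pos (.br L) n) : Pos (.br (B :: L)) n
  | inl {n : ℕ} (B : Bat) (L : List Bat) (q : Pos B n) : Pos (.br (B :: L)) (n + 1)

namespace Pos

/-- The source of a position. -/
def src : ∀ {B : Bat} {n : ℕ}, Pos.{u} B (n + 1) → Pos.{u} B n
  | _, _, .inr B L p => .inr B L (src p)
  | _, 0, .inl B L _ => .here (.br (B :: L))
  | _, _ + 1, .inl B L q => .inl B L (src q)

/-- The target of a position. -/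
def tgt : ∀ {B : Bat} {n : ℕ}, Pos.{u} B (n + 1) → Pos.{u} B n
  | _, _, .inr B L p => .inr B L (tgt p)
  | _, 0, .inl B L _ => .inr B L (.here (.br L))
  | _, _ + 1, .inl B L q => .inl B L (tgt q)

theorem src_src : ∀ {B : Bat} {n : ℕ} (p : Pos.{u} B (n + 2)), src (src p) = src (tgt p)
  | _, _, .inr B L p => by simp only [src, tgt, src_src p]
  | _, 0, .inl B L q => by simp only [src, tgt]
  | _, _ + 1, .inl B L q => by simp only [src, tgt, src_src q]

theorem tgt_tgt : ∀ {B : Bat} {n : ℕ} (p : Pos.{u} B (n + 2)), tgt (tgt p) = tgt (src p)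
  | _, _, .inr B L p => by simp only [src, tgt, tgt_tgt p]
  | _, 0, .inl B L q => by simp only [src, tgt]
  | _, _ + 1, .inl B L q => by simp only [src, tgt, tgt_tgt q]

end Pos

namespace Bat

/-- The globular set of positions of a Batanin tree. -/
def pos (B : Bat) : GlobularSet.{u} where
  cells := Pos.{u} B
  src := Pos.src
  tgt := Pos.tgt
  src_src := Pos.src_src
  tgt_tgt := Pos.tgt_tgt

/-- The set of `n`-dimensional source boundary positions. -/
def srcBdry (B : Bat) (n : ℕ) : Set (B.pos.cells n) :=
  {p | ¬ ∃ q : B.pos.cells (n + 1), B.pos.tgt q = p}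

/-- The set of `n`-dimensional target boundary positions. -/
def tgtBdry (B : Bat) (n : ℕ) : Set (B.pos.cells n) :=
  {p | ¬ ∃ q : B.pos.cells (n + 1), B.pos.src q = p}

end Bat

/-! ### Finite-dimensional computads -/

/-- The data constructed by recursion on `n`: the category of `n`-computads, the free
`n`-computad on a globular set, the functors of `n`-cells and of `n`-spheres, the projections
of a sphere onto its two cells, the sphere of a free computad given by a parallel pair of cells
of the globular set, and the full spheres of a Batanin tree. The actual data are constructed in
`computads` below. -/
structure ComputadData (n : ℕ) : Type (u + 2) where
  Obj : Type (u + 1)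
  [cat : Category.{u} Obj]
  Free : GlobularSet.{u} → Obj
  Cell : Obj ⥤ Type u
  Sph : Obj ⥤ Type u
  pr₁ : Sph ⟶ Cell
  pr₂ : Sph ⟶ Cell
  posSph : ∀ (X : GlobularSet.{u}) (a b : X.cells n), X.Parallel a b → Sph.obj (Free X)
  Full : ∀ B : Bat, Set (Sph.obj (Free B.pos))

attribute [instance] ComputadData.cat

/-- The data for `0`-computads, which are sets. -/
def computadsZero : ComputadData.{u} 0 where
  Obj := Type u
  Free X := X.cells 0
  Cell := 𝟭 (Type u)
  Sph :=
    { obj := fun C => C × C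
      map := fun σ => TypeCat.ofHom fun A => (σ A.1, σ A.2)  }
  pr₁ := { app := fun _ => TypeCat.ofHom fun A => A.1 }
  pr₂ := { app := fun _ => TypeCat.ofHom fun A => A.2 }
  posSph _ a b _ := (a, b)
  Full B := {A | A.1 ∈ B.srcBdry 0 ∧ A.2 ∈ B.tgtBdry 0}

namespace Step

variable {n : ℕ} (S : ComputadData.{u} n)

/-- An `(n + 1)`-computad over the data for `n`-computads: an `n`-computad, a set of generators
and an attaching function assigning a sphere to every generator. -/
structure Obj : Type (u + 1) where
  base : S.Obj
  gen : Type u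
  φ : gen → S.Sph.obj base

/-- The free `(n + 1)`-computad on a globular set. -/
def free (X : GlobularSet.{u}) : Obj S where
  base := S.Free X
  gen := X.cells (n + 1)
  φ x := S.posSph X (X.src x) (X.tgt x) (X.parallel_src_tgt x)

variable {S}

/-- Raw cells of an `(n + 1)`-computad: generators and coherences `coh (B, A, (τ, τV))`, where
the compatibility of `τV` with boundaries is not yet imposed. -/
inductive RawCell (C : Obj S) : Type u
  | var (v : C.gen) : RawCell C
  | coh (B : Bat) (hB : B.dim ≤ n + 1) (A : S.Sph.obj (S.Free B.pos)) (hA : A ∈ S.Full B)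
      (τ : S.Free B.pos ⟶ C.base) (τV : B.pos.cells (n + 1) → RawCell C) : RawCell C

namespace RawCell

/-- The boundary sphere of a raw cell. -/
def ty {C : Obj S} : RawCell C → S.Sph.obj C.base
  | var v => C.φ v
  | coh _ _ A _ τ _ => S.Sph.map τ A

/-- A raw cell is a cell when in every subterm `coh (B, A, (τ, τV))` the pair `(τ, τV)` is a
homomorphism `Free B → C`: the values of `τV` are cells, and `τV` is compatible with
boundaries. -/
def IsCell {C : Obj S} : RawCell C → Prop
  | var _ => True
  | coh B _ _ _ τ τV =>
      ∀ p, (τV p).IsCell ∧ (τV p).ty = S.Sph.map τ ((free S B.pos).φ p)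

/-- The support of a raw cell. -/
def supp {C : Obj S} : RawCell C → Set C.gen
  | var v => {v}
  | coh _ _ _ _ _ τV => ⋃ p, (τV p).supp

/-- The action on raw cells of a pair consisting of a homomorphism of the underlying
`n`-computads and a function from generators to raw cells. -/
def map {C D : Obj S} (σ : C.base ⟶ D.base) (σV : C.gen → RawCell D) : RawCell C → RawCell D
  | var v => σV v
  | coh B hB A hA τ τV => coh B hB A hA (τ ≫ σ) fun p => map σ σV (τV p)

theorem ty_map {C D : Obj S} (σ : C.base ⟶ D.base) (σV : C.gen → RawCell D)
    (hσ : ∀ v, (σV v).ty = S.Sph.map σ (C.φ v)) :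
    ∀ c : RawCell C, (map σ σV c).ty = S.Sph.map σ c.ty
  | var v => hσ v
  | coh B hB A hA τ τV => by simp [map, ty]

theorem isCell_map {C D : Obj S} (σ : C.base ⟶ D.base) (σV : C.gen → RawCell D)
    (hσ : ∀ v, (σV v).ty = S.Sph.map σ (C.φ v)) (hV : ∀ v, (σV v).IsCell) :
    ∀ c : RawCell C, c.IsCell → (map σ σV c).IsCell
  | var v, _ => hV v
  | coh B hB A hA τ τV, h => fun p =>
      ⟨isCell_map σ σV hσ hV (τV p) (h p).1, by rw [ty_map σ σV hσ, (h p).2, S.Sph.map_comp]; rfl⟩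

theorem map_var {C : Obj S} : ∀ c : RawCell C, map (𝟙 C.base) var c = c
  | var v => rfl
  | coh B hB A hA τ τV => by
      simp only [map, Category.comp_id, coh.injEq, heq_eq_eq, true_and]
      exact funext fun p => map_var (τV p)

theorem map_map {C D E : Obj S} (σ : C.base ⟶ D.base) (σV : C.gen → RawCell D)
    (ρ : D.base ⟶ E.base) (ρV : D.gen → RawCell E) :
    ∀ c : RawCell C, map ρ ρV (map σ σV c) = map (σ ≫ ρ) (fun v => map ρ ρV (σV v)) c
  | var v => rfl
  | coh B hB A hA τ τV => by
      simp only [map, Category.assoc, coh.injEq, heq_eq_eq, true_and]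
      exact funext fun p => map_map σ σV ρ ρV (τV p)

end RawCell

/-- The `(n + 1)`-cells of an `(n + 1)`-computad. -/
def Cell (C : Obj S) : Type u := {c : RawCell C // c.IsCell}

namespace Cell

/-- The cell given by a generator. -/
def var {C : Obj S} (v : C.gen) : Cell C := ⟨.var v, trivial⟩

/-- The boundary sphere of a cell. -/
def ty {C : Obj S} (c : Cell C) : S.Sph.obj C.base := c.1.ty

/-- The support of a cell. -/
def supp {C : Obj S} (c : Cell C) : Set C.gen := c.1.supp

end Cell

/-- A homomorphism of `(n + 1)`-computads. -/
@[ext]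
structure Hom (C D : Obj S) : Type u where
  base : C.base ⟶ D.base
  gen : C.gen → Cell D
  comm : ∀ v, (gen v).ty = S.Sph.map base (C.φ v)

/-- The cell `coh (B, A, τ)`. -/
def Cell.coh {C : Obj S} (B : Bat) (hB : B.dim ≤ n + 1) (A : S.Sph.obj (S.Free B.pos))
    (hA : A ∈ S.Full B) (τ : Hom (free S B.pos) C) : Cell C :=
  ⟨.coh B hB A hA τ.base fun p => (τ.gen p).1, fun p => ⟨(τ.gen p).2, τ.comm p⟩⟩

/-- The action of a homomorphism on cells. -/
def Cell.map {C D : Obj S} (σ : Hom C D) (c : Cell C) : Cell D :=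
  ⟨c.1.map σ.base fun v => (σ.gen v).1,
    RawCell.isCell_map _ _ σ.comm (fun v => (σ.gen v).2) _ c.2⟩

theorem Cell.ty_map {C D : Obj S} (σ : Hom C D) (c : Cell C) :
    (c.map σ).ty = S.Sph.map σ.base c.ty :=
  RawCell.ty_map _ _ σ.comm c.1

instance : Category.{u} (Obj S) where
  Hom := Hom
  id C := ⟨𝟙 C.base, Cell.var, fun v => by simp [Cell.var, Cell.ty, RawCell.ty]⟩
  comp σ ρ := ⟨σ.base ≫ ρ.base, fun v => (σ.gen v).map ρ,
    fun v => by rw [Cell.ty_map, σ.comm]; simp⟩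
  id_comp σ := Hom.ext (Category.id_comp _) rfl
  comp_id σ := Hom.ext (Category.comp_id _)
    (funext fun v => Subtype.ext (RawCell.map_var _))
  assoc σ ρ κ := Hom.ext (Category.assoc _ _ _)
    (funext fun v => Subtype.ext (RawCell.map_map _ _ _ _ _))

variable (S)

/-- The forgetful functor from `(n + 1)`-computads to `n`-computads. -/
def forget : Obj S ⥤ S.Obj where
  obj C := C.base
  map σ := Hom.base σ

/-- The functor of `(n + 1)`-cells. -/
def cell : Obj S ⥤ Type u where
  obj C := Cell C
  map σ := TypeCat.ofHom fun c => Cell.map σ c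
  map_id C := by
    ext c
    exact Subtype.ext (RawCell.map_var _)
  map_comp σ ρ := by
    ext c
    exact Subtype.ext (RawCell.map_map _ _ _ _ _).symm

/-- The boundary natural transformation. -/
def ty : cell S ⟶ forget S ⋙ S.Sph where
  app C := TypeCat.ofHom fun c => Cell.ty c
  naturality C D σ := by
    ext c
    exact Cell.ty_map σ c

variable {S}

/-- The `(n + 1)`-spheres of an `(n + 1)`-computad. -/
@[ext]
structure Sph (C : Obj S) : Type u where
  bdry : S.Sph.obj C.base
  fst : Cell C
  snd : Cell C
  ty_fst : fst.ty = bdry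
  ty_snd : snd.ty = bdry

variable (S)

/-- The functor of `(n + 1)`-spheres. -/
def sph : Obj S ⥤ Type u where
  obj C := Sph C
  map σ := TypeCat.ofHom fun A =>
    { bdry := S.Sph.map (Hom.base σ) A.bdry
      fst := Cell.map σ A.fst
      snd := Cell.map σ A.snd
      ty_fst := by rw [Cell.ty_map, A.ty_fst]
      ty_snd := by rw [Cell.ty_map, A.ty_snd] }
  map_id C := by
    apply ConcreteCategory.hom_ext
    intro A
    refine Sph.ext ?_ ?_ ?_
    · exact ConcreteCategory.congr_hom (S.Sph.map_id C.base) A.bdry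
    · exact ConcreteCategory.congr_hom ((cell S).map_id C) A.fst
    · exact ConcreteCategory.congr_hom ((cell S).map_id C) A.snd
  map_comp σ ρ := by
    apply ConcreteCategory.hom_ext
    intro A
    refine Sph.ext ?_ ?_ ?_
    · exact ConcreteCategory.congr_hom (S.Sph.map_comp (Hom.base σ) (Hom.base ρ)) A.bdry
    · exact ConcreteCategory.congr_hom ((cell S).map_comp σ ρ) A.fst
    · exact ConcreteCategory.congr_hom ((cell S).map_comp σ ρ) A.snd

/-- The sphere of the free computad on `X` given by a parallel pair of cells of `X`. -/
def posSph (X : GlobularSet.{u}) (a b : X.cells (n + 1)) (h : X.Parallel a b) :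
    Sph (free S X) where
  bdry := S.posSph X (X.src a) (X.tgt a) (X.parallel_src_tgt a)
  fst := Cell.var (C := free S X) a
  snd := Cell.var (C := free S X) b
  ty_fst := rfl
  ty_snd := by
    have h₁ : X.src a = X.src b := h.1
    have h₂ : X.tgt a = X.tgt b := h.2
    simp only [h₁, h₂]
    rfl

/-- The full spheres of a Batanin tree. -/
def full (B : Bat) : Set (Sph (free S B.pos)) :=
  {A | A.fst.supp = B.srcBdry (n + 1) ∧ A.snd.supp = B.tgtBdry (n + 1) ∧ A.bdry ∈ S.Full B}

end Step

/-- The data for `(n + 1)`-computads from those for `n`-computads. -/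
def computadsSucc {n : ℕ} (S : ComputadData.{u} n) : ComputadData.{u} (n + 1) where
  Obj := Step.Obj S
  Free := Step.free S
  Cell := Step.cell S
  Sph := Step.sph S
  pr₁ := { app := fun _ => TypeCat.ofHom fun A => Step.Sph.fst A }
  pr₂ := { app := fun _ => TypeCat.ofHom fun A => Step.Sph.snd A }
  posSph := Step.posSph S
  Full := Step.full S

/-- The category of `n`-computads with its associated structure, by recursion on `n`. -/
def computads : ∀ n : ℕ, ComputadData.{u} n
  | 0 => computadsZero
  | n + 1 => computadsSucc (computads n)

/-- The category of `n`-computads. -/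
abbrev FinComputad (n : ℕ) : Type (u + 1) := (computads.{u} n).Obj

/-- The functor of `n`-cells of an `n`-computad. -/
abbrev finCell (n : ℕ) : FinComputad.{u} n ⥤ Type u := (computads n).Cell

/-- The functor of `n`-spheres of an `n`-computad. -/
abbrev finSph (n : ℕ) : FinComputad.{u} n ⥤ Type u := (computads n).Sph

/-- The forgetful functor from `(n + 1)`-computads to `n`-computads. -/
def finForget (n : ℕ) : FinComputad.{u} (n + 1) ⥤ FinComputad.{u} n := Step.forget (computads n)

/-- The boundary sphere of an `(n + 1)`-cell. -/
def finTy (n : ℕ) : finCell.{u} (n + 1) ⟶ finForget n ⋙ finSph n := Step.ty (computads n)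

theorem finTy_pr (n : ℕ) (C : FinComputad.{u} (n + 1)) (A : (finSph (n + 1)).obj C) :
    (finTy n).app C ((computads (n + 1)).pr₁.app C A) =
      (finTy n).app C ((computads (n + 1)).pr₂.app C A) :=
  (Step.Sph.ty_fst A).trans (Step.Sph.ty_snd A).symm

/-- Generator-preserving homomorphisms of `n`-computads: all homomorphisms when `n = 0`, and
those that preserve generators in lower dimensions and send every top-dimensional generator to
a generator when `n > 0`. -/
def finGenPres : ∀ n : ℕ, MorphismProperty (FinComputad.{u} n)
  | 0 => fun _ _ _ => True
  | n + 1 => fun C D σ => finGenPres n ((finForget n).map σ) ∧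
      ∀ v : Step.Obj.gen C, ∃ w : Step.Obj.gen D, Step.Hom.gen σ v = Step.Cell.var w

theorem finGenPres_id : ∀ (n : ℕ) (C : FinComputad.{u} n), finGenPres n (𝟙 C)
  | 0, _ => trivial
  | n + 1, _ => ⟨finGenPres_id n _, fun v => ⟨v, rfl⟩⟩

theorem finGenPres_comp : ∀ (n : ℕ) {C D E : FinComputad.{u} n} (σ : C ⟶ D) (ρ : D ⟶ E),
    finGenPres n σ → finGenPres n ρ → finGenPres n (σ ≫ ρ)
  | 0, _, _, _, _, _, _, _ => trivial
  | n + 1, _, _, _, σ, ρ, hσ, hρ => by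
      refine ⟨finGenPres_comp n _ _ hσ.1 hρ.1, fun v => ?_⟩
      obtain ⟨w, hw⟩ := hσ.2 v
      obtain ⟨x, hx⟩ := hρ.2 w
      refine ⟨x, ?_⟩
      rw [← hx]
      exact congrArg (Step.Cell.map ρ) hw

/-! ### Infinite-dimensional computads -/

/-- A computad: an object of the limit of the categories of `n`-computads along the forgetful
functors. -/
structure Computad : Type (u + 1) where
  trunc : ∀ n : ℕ, FinComputad.{u} n
  forget_trunc : ∀ n : ℕ, (finForget n).obj (trunc (n + 1)) = trunc n

namespace Computad

/-- A homomorphism of computads: a sequence of homomorphisms of `n`-computads compatible with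
the forgetful functors. -/
@[ext]
structure Hom (C D : Computad.{u}) : Type u where
  trunc : ∀ n : ℕ, C.trunc n ⟶ D.trunc n
  forget_trunc : ∀ n : ℕ, (finForget n).map (trunc (n + 1)) ≫ eqToHom (D.forget_trunc n) =
    eqToHom (C.forget_trunc n) ≫ trunc n

instance : Category.{u} Computad.{u} where
  Hom := Hom
  id C := ⟨fun n => 𝟙 (C.trunc n), fun n => by simp⟩
  comp σ ρ := ⟨fun n => σ.trunc n ≫ ρ.trunc n, fun n => by
    rw [Functor.map_comp, Category.assoc, ρ.forget_trunc, ← Category.assoc, σ.forget_trunc,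
      Category.assoc]⟩
  id_comp σ := Hom.ext (funext fun n => Category.id_comp _)
  comp_id σ := Hom.ext (funext fun n => Category.comp_id _)
  assoc σ ρ κ := Hom.ext (funext fun n => Category.assoc _ _ _)

/-- The boundary `n`-sphere of an `(n + 1)`-cell of a computad. -/
def ty (C : Computad.{u}) (n : ℕ) (c : (finCell (n + 1)).obj (C.trunc (n + 1))) :
    (finSph n).obj (C.trunc n) :=
  (finSph n).map (eqToHom (C.forget_trunc n)) ((finTy n).app (C.trunc (n + 1)) c)

theorem ty_pr (C : Computad.{u}) (n : ℕ) (A : (finSph (n + 1)).obj (C.trunc (n + 1))) :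
    C.ty n ((computads (n + 1)).pr₁.app _ A) = C.ty n ((computads (n + 1)).pr₂.app _ A) :=
  congrArg ((finSph n).map (eqToHom (C.forget_trunc n))) (finTy_pr n _ A)

theorem ty_naturality {C D : Computad.{u}} (σ : C ⟶ D) (n : ℕ)
    (c : (finCell (n + 1)).obj (C.trunc (n + 1))) :
    D.ty n ((finCell (n + 1)).map (Hom.trunc σ (n + 1)) c) =
      (finSph n).map (Hom.trunc σ n) (C.ty n c) := by
  have h := ConcreteCategory.congr_hom ((finTy n).naturality (Hom.trunc σ (n + 1))) c
  have h' := congrArg (fun f => (finSph n).map f ((finTy n).app (C.trunc (n + 1)) c))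
    (Hom.forget_trunc σ n)
  simp only [Functor.map_comp] at h'
  refine (congrArg ((finSph n).map (eqToHom (D.forget_trunc n))) h).trans h'

/-- The functor sending a computad to its globular set of cells; the source and the target of an
`(n + 1)`-cell are the first and the second cell of its boundary sphere. -/
def cell : Computad.{u} ⥤ GlobularSet.{u} where
  obj C :=
    { cells := fun n => (finCell n).obj (C.trunc n)
      src := fun {n} c => (computads n).pr₁.app _ (C.ty n c)
      tgt := fun {n} c => (computads n).pr₂.app _ (C.ty n c)
      src_src := fun {n} c => congrArg ((computads n).pr₁.app _) (C.ty_pr n (C.ty (n + 1) c))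
      tgt_tgt := fun {n} c => congrArg ((computads n).pr₂.app _) (C.ty_pr n (C.ty (n + 1) c)).symm }
  map σ :=
    { map := fun n => (finCell n).map (Hom.trunc σ n)
      map_src := fun {n} c => 
        (NatTrans.naturality_apply (computads n).pr₁ (Hom.trunc σ n) _).symm.trans
          (congrArg ((computads n).pr₁.app _) (ty_naturality σ n c).symm)
      map_tgt := fun {n} c => 
        (NatTrans.naturality_apply (computads n).pr₂ (Hom.trunc σ n) _).symm.trans
          (congrArg ((computads n).pr₂.app _) (ty_naturality σ n c).symm) }
  map_id C := by
    apply GlobularSet.Hom.ext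
    funext n c
    exact ConcreteCategory.congr_hom ((finCell n).map_id (C.trunc n)) c
  map_comp σ ρ := by
    apply GlobularSet.Hom.ext
    funext n c
    exact ConcreteCategory.congr_hom ((finCell n).map_comp (Hom.trunc σ n) (Hom.trunc ρ n)) c

/-- The functor sending a computad to its globular set of spheres; the source and the target of
an `(n + 1)`-sphere are the common boundary sphere of its two cells. -/
def sph : Computad.{u} ⥤ GlobularSet.{u} where
  obj C :=
    { cells := fun n => (finSph n).obj (C.trunc n)
      src := fun {n} A => C.ty n ((computads (n + 1)).pr₁.app _ A)
      tgt := fun {n} A => C.ty n ((computads (n + 1)).pr₂.app _ A)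
      src_src := fun {n} A => by rw [C.ty_pr (n + 1)]
      tgt_tgt := fun {n} A => by rw [C.ty_pr (n + 1)] }
  map σ :=
    { map := fun n => (finSph n).map (Hom.trunc σ n)
      map_src := fun {n} A => 
        (ty_naturality σ n _).symm.trans
          (congrArg (Computad.ty _ n) (NatTrans.naturality_apply (computads (n + 1)).pr₁ _ A).symm)
      map_tgt := fun {n} A => 
        (ty_naturality σ n _).symm.trans
          (congrArg (Computad.ty _ n) (NatTrans.naturality_apply (computads (n + 1)).pr₂ _ A).symm) }
  map_id C := by
    apply GlobularSet.Hom.ext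
    funext n c
    exact ConcreteCategory.congr_hom ((finSph n).map_id (C.trunc n)) c
  map_comp σ ρ := by
    apply GlobularSet.Hom.ext
    funext n c
    exact ConcreteCategory.congr_hom ((finSph n).map_comp (Hom.trunc σ n) (Hom.trunc ρ n)) c

/-- Generator-preserving homomorphisms of computads. -/
def genPres : MorphismProperty Computad.{u} := fun _ _ σ => ∀ n, finGenPres n (Hom.trunc σ n)

instance : (genPres.{u}).IsMultiplicative where
  id_mem _ n := finGenPres_id n _
  comp_mem _ _ hσ hρ n := finGenPres_comp n _ _ (hσ n) (hρ n)

end Computad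

/-- The category of computads and generator-preserving homomorphisms. -/
abbrev ComputadVar : Type (u + 1) := WideSubcategory Computad.genPres.{u}

namespace ComputadVar

/-- The restriction of the functor of cells to generator-preserving homomorphisms. -/
def cell : ComputadVar.{u} ⥤ GlobularSet.{u} := wideSubcategoryInclusion _ ⋙ Computad.cell

/-- The restriction of the functor of spheres to generator-preserving homomorphisms. -/
def sph : ComputadVar.{u} ⥤ GlobularSet.{u} := wideSubcategoryInclusion _ ⋙ Computad.sph

end ComputadVar

end OmegaComputad

namespace OmegaComputad

/-! ### Elements with representable fibres -/

section RepAt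

variable {D : Type*} [Category.{u} D] {T : D} (hT : IsTerminal T)

/-- The fibre over `x : F.obj T` of the functor `F` is corepresentable: there is a generic
element over `x`, from which every element over `x` arises along a unique morphism. -/
def RepAt (F : D ⥤ Type u) (x : F.obj T) : Prop :=
  ∃ (J : D) (j : F.obj J), F.map (hT.from J) j = x ∧
    ∀ (C : D) (c : F.obj C), F.map (hT.from C) c = x → ∃! g : J ⟶ C, F.map g j = c

theorem map_from_naturality {F G : D ⥤ Type u} (a : F ⟶ G) {C : D} {c : F.obj C}
    {x : F.obj T} (h : F.map (hT.from C) c = x) :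
    G.map (hT.from C) (a.app C c) = a.app T x := by
  rw [← h]
  exact (NatTrans.naturality_apply a _ c).symm

theorem map_from_map (F : D ⥤ Type u) {C E : D} (f : C ⟶ E) (c : F.obj C) :
    F.map (hT.from E) (F.map f c) = F.map (hT.from C) c := by
  rw [← hT.hom_ext (f ≫ hT.from E) (hT.from C), Functor.map_comp]
  rfl

/-- Representability of fibres does not depend on the choice of the terminal object. -/
theorem RepAt.of_terminal {T' : D} (hT' : IsTerminal T') {F : D ⥤ Type u}
    (h : ∀ x : F.obj T, RepAt hT F x) (x : F.obj T') : RepAt hT' F x := by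
  have key : ∀ {C : D} (c : F.obj C), F.map (hT'.from T) (F.map (hT.from C) c) =
      F.map (hT'.from C) c := fun c => map_from_map hT' F _ c
  have key' : ∀ {C : D} (c : F.obj C), F.map (hT.from T') (F.map (hT'.from C) c) =
      F.map (hT.from C) c := fun c => map_from_map hT F _ c
  obtain ⟨J, j, hj, hu⟩ := h (F.map (hT.from T') x)
  refine ⟨J, j, ?_, fun C c hc => hu C c ?_⟩
  · rw [← key, hj, key]
    simp
  · rw [← key', hc]

/-- Representability of fibres transfers along a natural transformation which is injective, and
whose image contains all elements over `a x`. -/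
theorem RepAt.of_mono {F G : D ⥤ Type u} (a : F ⟶ G) {x : F.obj T} (h : RepAt hT F x)
    (hinj : ∀ C, Function.Injective (a.app C))
    (hsurj : ∀ (C : D) (d : G.obj C), G.map (hT.from C) d = a.app T x → ∃ c, a.app C c = d) :
    RepAt hT G (a.app T x) := by
  obtain ⟨J, j, hj, hu⟩ := h
  refine ⟨J, a.app J j, map_from_naturality hT a hj, fun C d hd => ?_⟩
  obtain ⟨c, rfl⟩ := hsurj C d hd
  have hc : F.map (hT.from C) c = x :=
    hinj T ((NatTrans.naturality_apply a _ c).trans hd)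
  obtain ⟨g, hg, hgu⟩ := hu C c hc
  refine ⟨g, ?_, fun g' hg' => hgu g' (hinj C ?_)⟩
  · simp only [← hg]
    exact (NatTrans.naturality_apply a _ j).symm
  · rw [← hg']
    exact NatTrans.naturality_apply a _ j

/-- In a cocomplete category, representability of fibres is inherited by a functor which is the
limit of functors `A` and `B i` glued along functors `S i`. -/
theorem RepAt.of_limit [HasColimitsOfSize.{u, u} D] {P A : D ⥤ Type u} {I : Type u}
    {B S : I → (D ⥤ Type u)} (a : P ⟶ A) (b : ∀ i, P ⟶ B i) (α : ∀ i, A ⟶ S i)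
    (β : ∀ i, B i ⟶ S i)
    (hcomm : ∀ (C : D) (p : P.obj C) (i : I),
      (α i).app C (a.app C p) = (β i).app C ((b i).app C p))
    (hlim : ∀ (C : D) (x : A.obj C) (y : ∀ i, (B i).obj C),
      (∀ i, (α i).app C x = (β i).app C (y i)) →
        ∃ p : P.obj C, a.app C p = x ∧ ∀ i, (b i).app C p = y i)
    (hext : ∀ (C : D) (p q : P.obj C), a.app C p = a.app C q →
      (∀ i, (b i).app C p = (b i).app C q) → p = q)
    (p : P.obj T) (hA : RepAt hT A (a.app T p)) (hB : ∀ i, RepAt hT (B i) ((b i).app T p))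
    (hS : ∀ i, RepAt hT (S i) ((α i).app T (a.app T p))) : RepAt hT P p := by
  obtain ⟨JA, ja, hja, uA⟩ := hA
  choose JB jb hjb uB using hB
  choose JS js hjs uS using hS
  have hu : ∀ i, ∃ g : JS i ⟶ JA, (S i).map g (js i) = (α i).app JA ja := fun i =>
    (uS i JA _ (map_from_naturality hT (α i) hja)).exists
  have hv : ∀ i, ∃ g : JS i ⟶ JB i, (S i).map g (js i) = (β i).app (JB i) (jb i) := fun i =>
    (uS i (JB i) _ ((map_from_naturality hT (β i) (hjb i)).trans (hcomm T p i).symm)).exists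
  choose v hv using hv
  choose w hw using hu
  let ιA : JA ⟶ pushout (Limits.Sigma.desc w) (Limits.Sigma.map v) := pushout.inl _ _
  let ιB : ∀ i, JB i ⟶ pushout (Limits.Sigma.desc w) (Limits.Sigma.map v) := fun i =>
    Limits.Sigma.ι JB i ≫ pushout.inr _ _
  have hι : ∀ i, w i ≫ ιA = v i ≫ ιB i := fun i => by
    have := congrArg (fun f => Limits.Sigma.ι JS i ≫ f)
      (pushout.condition (f := Limits.Sigma.desc w) (g := Limits.Sigma.map v))
    simpa [ιA, ιB] using this
  obtain ⟨q, hqa, hqb⟩ := hlim _ (A.map ιA ja) (fun i => (B i).map (ιB i) (jb i)) (fun i => by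
    have h₁ := NatTrans.naturality_apply (α i) ιA ja
    have h₂ := NatTrans.naturality_apply (β i) (ιB i) (jb i)
    rw [h₁, h₂, ← hw, ← hv]
    have := congrArg (fun f => (S i).map f (js i)) (hι i)
    simpa using this)
  refine ⟨_, q, ?_, fun C c hc => ?_⟩
  · apply hext
    · rw [NatTrans.naturality_apply, hqa, map_from_map, hja]
    · intro i
      rw [NatTrans.naturality_apply, hqb, map_from_map, hjb]
  · have hcA := map_from_naturality hT a hc
    have hcB := fun i => map_from_naturality hT (b i) hc
    obtain ⟨gA, hgA, hgAu⟩ := uA C _ hcA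
    choose gB hgB hgBu using fun i => uB i C _ (hcB i)
    have hg : ∀ i, w i ≫ gA = v i ≫ gB i := fun i => by
      refine (uS i C _ (map_from_naturality hT (α i) hcA)).unique ?_ ?_
      · rw [Functor.map_comp]
        refine (congrArg ((S i).map gA) (hw i)).trans ?_
        rw [← NatTrans.naturality_apply, hgA]
      · rw [Functor.map_comp]
        refine (congrArg ((S i).map (gB i)) (hv i)).trans ?_
        rw [← NatTrans.naturality_apply]
        simp only at hgB
        rw [hgB, hcomm]
    refine ⟨pushout.desc gA (Limits.Sigma.desc gB) (by ext i; simp [hg]), ?_, fun g hgc => ?_⟩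
    · apply hext
      · rw [NatTrans.naturality_apply, hqa, ← hgA, ← Functor.map_comp_apply, pushout.inl_desc]
      · intro i
        rw [NatTrans.naturality_apply, hqb, ← hgB i, ← Functor.map_comp_apply, Category.assoc,
          pushout.inr_desc, Limits.Sigma.ι_desc]
    · apply pushout.hom_ext
      · rw [pushout.inl_desc]
        apply hgAu
        have := congrArg (a.app C) hgc
        rw [NatTrans.naturality_apply, hqa] at this
        simpa using this
      · rw [pushout.inr_desc]
        ext i
        rw [Limits.Sigma.ι_desc]
        apply hgBu
        have := congrArg ((b i).app C) hgc
        rw [NatTrans.naturality_apply, hqb] at this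
        simpa [ιB] using this

end RepAt

/-! ### Familial representability from generic elements -/

namespace GlobularSet

theorem Hom.map_paths_lift {X Y : GlobularSet.{u}} (f : X ⟶ Y) {a b : GlobeQuiver}
    (p : Quiver.Path a b) (x : X.cells b.dim) :
    Hom.map f a.dim (((Paths.lift X.prefunctor).map p).unop x) =
      ((Paths.lift Y.prefunctor).map p).unop (Hom.map f b.dim x) := by
  induction p with
  | nil => rfl
  | @cons b c p q ih =>
    change GlobeQuiver.Hom b c at q
    cases q with
    | s n => exact (ih _).trans (congrArg ((Paths.lift Y.prefunctor).map p).unop (f.map_src x))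
    | t n => exact (ih _).trans (congrArg ((Paths.lift Y.prefunctor).map p).unop (f.map_tgt x))

theorem Hom.map_presheaf_map {X Y : GlobularSet.{u}} (f : X ⟶ Y) {g g' : Globe} (e : g ⟶ g')
    (x : X.cells g'.as.dim) :
    Hom.map f g.as.dim (X.presheaf.map e.op x) =
      Y.presheaf.map e.op (Hom.map f g'.as.dim x) := by
  obtain ⟨p, rfl⟩ := (CategoryTheory.Quotient.functor GlobeRel).map_surjective e
  exact map_paths_lift f p x

/-- The functor of `n`-cells of globular sets. -/
def cellsFunctor (n : ℕ) : GlobularSet.{u} ⥤ Type u where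
  obj X := X.cells n
  map f := TypeCat.ofHom (Hom.map f n)

variable {D : Type*} [Category.{u} D] {T : D} (hT : IsTerminal T)

theorem exists_familial (F : D ⥤ GlobularSet.{u})
    (hF : ∀ (n : ℕ) (x : (F.obj T).cells n), RepAt hT (F ⋙ cellsFunctor n) x) :
    ∃ (J : (F.obj T).El ⥤ D) (α : F ≅ (F.obj T).familial J),
      ∀ (C : D) (n : ℕ) (c : (F.obj C).cells n),
        (Hom.map (α.hom.app C) n c).1 = Hom.map (F.map (hT.from C)) n c := by
  choose J j hj uJ using hF
  have fmap_comp : ∀ {A B C : D} (f : A ⟶ B) (g : B ⟶ C) {n : ℕ} (x : (F.obj A).cells n),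
      Hom.map (F.map (f ≫ g)) n x = Hom.map (F.map g) n (Hom.map (F.map f) n x) := by
    intro A B C f g n x
    rw [F.map_comp]
    rfl
  have from_map : ∀ {A B : D} (f : A ⟶ B) {n : ℕ} (x : (F.obj A).cells n),
      Hom.map (F.map (hT.from B)) n (Hom.map (F.map f) n x) =
        Hom.map (F.map (hT.from A)) n x := by
    intro A B f n x
    rw [← fmap_comp, hT.hom_ext (f ≫ hT.from B) (hT.from A)]
  replace hj : ∀ n x, Hom.map (F.map (hT.from (J n x))) n (j n x) = x := hj
  replace uJ : ∀ n x C (c : (F.obj C).cells n), Hom.map (F.map (hT.from C)) n c = x →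
    ∃! g : J n x ⟶ C, Hom.map (F.map g) n (j n x) = c := uJ
  have hmor : ∀ {e e' : (F.obj T).El} (f : e ⟶ e'),
      ∃! g : J e.unop.1.unop.as.dim e.unop.2 ⟶ J e'.unop.1.unop.as.dim e'.unop.2,
        Hom.map (F.map g) e.unop.1.unop.as.dim (j _ _) =
          (F.obj _).presheaf.map f.unop.1 (j e'.unop.1.unop.as.dim e'.unop.2) := by
    intro e e' f
    apply uJ
    refine (Hom.map_presheaf_map (F.map (hT.from _)) f.unop.1.unop _).trans ?_
    refine (congrArg ((F.obj T).presheaf.map f.unop.1) (hj _ _)).trans f.unop.2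
  choose m hm mu using @hmor
  simp only at hm
  let JF : (F.obj T).El ⥤ D :=
    { obj := fun e => J e.unop.1.unop.as.dim e.unop.2
      map := fun f => m f
      map_id := fun e => by
        symm
        apply mu
        simp only [F.map_id]
        exact (ConcreteCategory.congr_hom ((F.obj _).presheaf.map_id _) _).symm
      map_comp := fun {e e' e''} f g => by
        symm
        apply mu
        refine (fmap_comp (m f) (m g) _).trans ((congrArg (Hom.map (F.map (m g)) _) (hm f)).trans ?_)
        refine (Hom.map_presheaf_map (F.map (m g)) f.unop.1.unop _).trans ?_
        refine (congrArg ((F.obj _).presheaf.map f.unop.1) (hm g)).trans ?_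
        exact (ConcreteCategory.congr_hom
          ((F.obj _).presheaf.map_comp g.unop.1 f.unop.1) _).symm }
  have bij : ∀ (C : D) (n : ℕ) (c : (F.obj C).cells n),
      ∃! p : (((F.obj T).familial JF).obj C).cells n, Hom.map (F.map p.2) n (j n p.1) = c := by
    intro C n c
    obtain ⟨g, hg, hgu⟩ := uJ n _ C c rfl
    refine ⟨⟨_, g⟩, hg, ?_⟩
    rintro ⟨x, g'⟩ hg'
    change Hom.map (F.map g') n (j n x) = c at hg'
    obtain rfl : x = Hom.map (F.map (hT.from C)) n c := by
      rw [← hg']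
      exact ((from_map g' (j n x)).trans (hj n x)).symm
    exact Sigma.ext rfl (heq_of_eq (hgu g' hg'))
  choose q hq hqu using bij
  simp only at hq
  have qsrc : ∀ (C : D) {n : ℕ} (c : (F.obj C).cells (n + 1)),
      q C n ((F.obj C).src c) = (((F.obj T).familial JF).obj C).src (q C (n + 1) c) := by
    intro C n c
    symm
    apply hqu
    refine (fmap_comp (JF.map (El.s _)) _ _).trans ?_
    refine (congrArg (Hom.map (F.map _) n) (hm (El.s (q C (n + 1) c).1))).trans ?_
    exact (Hom.map_src (F.map (q C (n + 1) c).2) _).trans (congrArg _ (hq C (n + 1) c))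
  have qtgt : ∀ (C : D) {n : ℕ} (c : (F.obj C).cells (n + 1)),
      q C n ((F.obj C).tgt c) = (((F.obj T).familial JF).obj C).tgt (q C (n + 1) c) := by
    intro C n c
    symm
    apply hqu
    refine (fmap_comp (JF.map (El.t _)) _ _).trans ?_
    refine (congrArg (Hom.map (F.map _) n) (hm (El.t (q C (n + 1) c).1))).trans ?_
    exact (Hom.map_tgt (F.map (q C (n + 1) c).2) _).trans (congrArg _ (hq C (n + 1) c))
  let iso : ∀ C : D, F.obj C ≅ ((F.obj T).familial JF).obj C := fun C =>
    { hom := ⟨q C, qsrc C, qtgt C⟩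
      inv := ⟨fun n p => Hom.map (F.map p.2) n (j n p.1),
        fun {n} p => by
          have h := hqu C _ _ p rfl
          have := qsrc C (Hom.map (F.map p.2) (n + 1) (j _ p.1))
          rw [← h] at this
          rw [← this, hq],
        fun {n} p => by
          have h := hqu C _ _ p rfl
          have := qtgt C (Hom.map (F.map p.2) (n + 1) (j _ p.1))
          rw [← h] at this
          rw [← this, hq]⟩
      hom_inv_id := Hom.ext (funext fun n => funext fun c => hq C n c)
      inv_hom_id := Hom.ext (funext fun n => funext fun p => (hqu C n _ p rfl).symm) }
  refine ⟨JF, NatIso.ofComponents iso ?_, ?_⟩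
  · intro C E f
    refine Hom.ext (funext fun n => funext fun c => ?_)
    symm
    apply hqu
    refine (fmap_comp (q C n c).2 f _).trans ?_
    exact congrArg (Hom.map (F.map f) n) (hq C n c)
  · intro C n c
    change (q C n c).1 = _
    conv_rhs => rw [← hq C n c]
    exact ((from_map (q C n c).2 (j n _)).trans (hj n _)).symm

end GlobularSet

/-! ### Generator-preserving homomorphisms in successive dimensions -/

namespace Step

variable {n : ℕ} {S : ComputadData.{u} n}

theorem Cell.var_injective {C : Obj S} : Function.Injective (Cell.var : C.gen → Cell C) :=
  fun _ _ h => RawCell.var.inj (congrArg Subtype.val h)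

variable (G : MorphismProperty S.Obj)

/-- Homomorphisms of `(n + 1)`-computads which send generators to generators, and whose
underlying homomorphism of `n`-computads satisfies `G`. -/
def genPres : MorphismProperty (Obj S) := fun _ _ σ =>
  G (Hom.base σ) ∧ ∀ v, ∃ w, Hom.gen σ v = Cell.var w

variable [G.IsMultiplicative]

instance : (genPres G).IsMultiplicative where
  id_mem _ := ⟨G.id_mem _, fun v => ⟨v, rfl⟩⟩
  comp_mem σ ρ hσ hρ := by
    refine ⟨G.comp_mem _ _ hσ.1 hρ.1, fun v => ?_⟩
    obtain ⟨w, hw⟩ := hσ.2 v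
    obtain ⟨x, hx⟩ := hρ.2 w
    exact ⟨x, (congrArg (Cell.map ρ) hw).trans hx⟩

/-- The category of `(n + 1)`-computads and generator-preserving homomorphisms. -/
abbrev Var : Type (u + 1) := WideSubcategory (genPres G)

/-- The functor of `n`-spheres on generator-preserving homomorphisms. -/
abbrev baseSph : WideSubcategory G ⥤ Type u := wideSubcategoryInclusion G ⋙ S.Sph

/-- The functor of homomorphisms out of `X` on generator-preserving homomorphisms. -/
abbrev baseHom (X : S.Obj) : WideSubcategory G ⥤ Type u :=
  wideSubcategoryInclusion G ⋙ coyoneda.obj (Opposite.op X)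

/-- The functor of `(n + 1)`-cells on generator-preserving homomorphisms. -/
abbrev varCell : Var G ⥤ Type u := wideSubcategoryInclusion _ ⋙ cell S

/-- The functor of `(n + 1)`-spheres on generator-preserving homomorphisms. -/
abbrev varSph : Var G ⥤ Type u := wideSubcategoryInclusion _ ⋙ sph S

/-- The functor of homomorphisms out of `X` on generator-preserving homomorphisms. -/
abbrev varHom (X : Obj S) : Var G ⥤ Type u :=
  wideSubcategoryInclusion _ ⋙ coyoneda.obj (Opposite.op X)

/-- The forgetful functor to `n`-computads on generator-preserving homomorphisms. -/
def varForget : Var G ⥤ WideSubcategory G where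
  obj C := ⟨C.obj.base⟩
  map σ := ⟨Hom.base σ.hom, σ.property.1⟩

variable {G}

/-- The generator-preserving homomorphism given by a homomorphism of the underlying
`n`-computads and a compatible function between the sets of generators. -/
def homMk {C D : Var G} (σ : C.obj.base ⟶ D.obj.base) (hσ : G σ) (f : C.obj.gen → D.obj.gen)
    (hf : ∀ v, D.obj.φ (f v) = S.Sph.map σ (C.obj.φ v)) : C ⟶ D :=
  ⟨⟨σ, fun v => Cell.var (f v), hf⟩, hσ, fun v => ⟨f v, rfl⟩⟩

theorem var_hom_ext {C D : Var G} {σ τ : C ⟶ D} (h : Hom.base σ.hom = Hom.base τ.hom)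
    (h' : ∀ v, Hom.gen σ.hom v = Hom.gen τ.hom v) : σ = τ :=
  WideSubcategory.hom_ext _ (Hom.ext h (funext h'))

theorem exists_eq_homMk {C D : Var G} (σ : C ⟶ D) :
    ∃ (b : C.obj.base ⟶ D.obj.base) (hb : G b) (f : C.obj.gen → D.obj.gen)
      (hf : ∀ v, D.obj.φ (f v) = S.Sph.map b (C.obj.φ v)), σ = homMk b hb f hf := by
  choose f hf using σ.property.2
  refine ⟨Hom.base σ.hom, σ.property.1, f, fun v => ?_, var_hom_ext rfl hf⟩
  rw [← Hom.comm, hf]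
  rfl

variable (G) in
/-- The functor identifying generator-preserving homomorphisms of `(n + 1)`-computads with
morphisms of a comma category. -/
def fromComma : Comma (𝟭 (Type u)) (baseSph G) ⥤ Var G where
  obj X := ⟨⟨X.right.obj, X.left, fun v => X.hom v⟩⟩
  map f := homMk f.right.hom f.right.property (fun v => f.left v)
    (fun v => ConcreteCategory.congr_hom f.w v)
  map_id _ := var_hom_ext rfl fun _ => rfl
  map_comp _ _ := var_hom_ext rfl fun _ => rfl

instance : (fromComma G).Faithful where
  map_injective {X Y f g} h := by
    have h' := congrArg InducedWideCategory.Hom.hom h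
    refine CommaMorphism.ext ?_ ?_
    · ext v
      exact Cell.var_injective (congrFun (congrArg Hom.gen h') v)
    · exact WideSubcategory.hom_ext _ (congrArg Hom.base h')

instance : (fromComma G).Full where
  map_surjective {X Y} σ := by
    obtain ⟨b, hb, f, hf, h⟩ := exists_eq_homMk σ
    refine ⟨⟨TypeCat.ofHom f, ⟨b, hb⟩, ?_⟩, h.symm⟩
    apply ConcreteCategory.hom_ext
    exact hf

instance : (fromComma G).EssSurj where
  mem_essImage C := ⟨⟨C.obj.gen, ⟨C.obj.base⟩, TypeCat.ofHom C.obj.φ⟩, ⟨Iso.refl _⟩⟩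

instance : (fromComma G).IsEquivalence where

theorem hasColimits_var [HasColimitsOfSize.{u, u} (WideSubcategory G)] :
    HasColimitsOfSize.{u, u} (Var G) :=
  Adjunction.has_colimits_of_equivalence (fromComma G).inv

/-! ### The terminal object and generic elements in dimension `n + 1` -/

/-- The `(n + 1)`-computad with one generator for each sphere of `T`. -/
def top (T : WideSubcategory G) : Var G := ⟨⟨T.obj, S.Sph.obj T.obj, fun A => A⟩⟩

/-- The `(n + 1)`-computad with one generator for each sphere of a terminal object is terminal. -/
def isTerminalTop {T : WideSubcategory G} (hT : IsTerminal T) : IsTerminal (top T) :=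
  IsTerminal.ofUniqueHom
    (fun C => homMk (hT.from ((varForget G).obj C)).hom (hT.from ((varForget G).obj C)).property
      (fun v => S.Sph.map (hT.from ((varForget G).obj C)).hom (C.obj.φ v)) (fun _ => rfl))
    (fun C σ => by
      have h : (varForget G).map σ = hT.from _ := hT.hom_ext _ _
      obtain ⟨b, hb, f, hf, rfl⟩ := exists_eq_homMk σ
      replace h : b = (hT.from ((varForget G).obj C)).hom :=
        congrArg InducedWideCategory.Hom.hom h
      refine var_hom_ext h fun v => ?_
      exact congrArg Cell.var
        ((hf v).trans (congrArg (fun b => S.Sph.map b (C.obj.φ v)) h)))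

variable {T : WideSubcategory G} (hT : IsTerminal T)

theorem varForget_from (C : Var G) :
    (varForget G).map ((isTerminalTop hT).from C) = hT.from ((varForget G).obj C) :=
  hT.hom_ext _ _

theorem repAt_forget (F : WideSubcategory G ⥤ Type u) {x : F.obj T} (h : RepAt hT F x) :
    RepAt (isTerminalTop hT) (varForget G ⋙ F) x := by
  obtain ⟨J, j, hj, hu⟩ := h
  refine ⟨⟨⟨J.obj, PEmpty, PEmpty.elim⟩⟩, j, ?_, fun C c hc => ?_⟩
  · rw [Functor.comp_map, varForget_from]
    exact hj
  · rw [Functor.comp_map, varForget_from] at hc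
    obtain ⟨g, hg, hgu⟩ := hu _ c hc
    refine ⟨homMk g.hom g.property PEmpty.elim (fun v => v.elim), hg, fun g' hg' => ?_⟩
    have := hgu ((varForget G).map g') hg'
    exact var_hom_ext (congrArg InducedWideCategory.Hom.hom this) (fun v => v.elim)

theorem repAt_var {v : S.Sph.obj T.obj} (h : RepAt hT (baseSph G) v) :
    RepAt (isTerminalTop hT) (varCell G) (Cell.var v : Cell (top T).obj) := by
  obtain ⟨J, j, hj, hu⟩ := h
  refine ⟨⟨⟨J.obj, PUnit, fun _ => j⟩⟩, Cell.var PUnit.unit, congrArg Cell.var hj,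
    fun C c hc => ?_⟩
  obtain ⟨c, hc'⟩ := c
  cases c with
  | coh B hB A hA τ τV => cases congrArg Subtype.val hc
  | var w =>
    obtain ⟨g, hg, hgu⟩ := hu ((varForget G).obj C) (C.obj.φ w) (Cell.var_injective hc)
    refine ⟨homMk g.hom g.property (fun _ => w) (fun _ => hg.symm), rfl, fun σ hσ => ?_⟩
    obtain ⟨b, hb, f, hf, rfl⟩ := exists_eq_homMk σ
    have hf' : f PUnit.unit = w := Cell.var_injective hσ
    have hb' := hgu ⟨b, hb⟩ ((hf PUnit.unit).symm.trans (congrArg C.obj.φ hf'))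
    exact var_hom_ext (congrArg InducedWideCategory.Hom.hom hb') (fun _ => hσ)

section Limits

variable [HasColimitsOfSize.{u, u} (WideSubcategory G)]

variable (G) in
/-- The boundary of cells, as a natural transformation for generator-preserving homomorphisms. -/
def varTy : varCell G ⟶ varForget G ⋙ baseSph G where
  app C := (ty S).app C.obj
  naturality _ _ σ := (ty S).naturality σ.hom

theorem repAt_hom (X : Obj S) (τ : X ⟶ (top T).obj)
    (hSph : ∀ A, RepAt hT (baseSph G) A)
    (hHom : ∀ τ : X.base ⟶ T.obj, RepAt hT (baseHom G X.base) τ)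
    (hCell : ∀ v, RepAt (isTerminalTop hT) (varCell G) (Hom.gen τ v)) :
    RepAt (isTerminalTop hT) (varHom G X) τ := by
  have := hasColimits_var (G := G)
  refine RepAt.of_limit (isTerminalTop hT) (P := varHom G X) (A := varForget G ⋙ baseHom G X.base)
    (I := X.gen) (B := fun _ => varCell G) (S := fun _ => varForget G ⋙ baseSph G)
    { app := fun C => TypeCat.ofHom fun σ => Hom.base σ
      naturality := fun _ _ _ => rfl }
    (fun v =>
      { app := fun C => TypeCat.ofHom fun σ => Hom.gen σ v
        naturality := fun _ _ _ => rfl })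
    (fun v =>
      { app := fun C => TypeCat.ofHom fun σ => S.Sph.map σ (X.φ v)
        naturality := fun C D σ => by
          ext ρ
          exact Functor.map_comp_apply S.Sph ρ (Hom.base σ.hom) (X.φ v) })
    (fun _ => varTy G) ?_ ?_ ?_ τ (repAt_forget hT _ (hHom _)) hCell
    (fun v => repAt_forget hT _ (hSph _))
  · exact fun C σ v => (Hom.comm σ v).symm
  · exact fun C σ f h => ⟨⟨σ, f, fun v => (h v).symm⟩, rfl, fun _ => rfl⟩
  · exact fun C σ ρ h h' => Hom.ext h (funext h')

theorem repAt_cell (hSph : ∀ A, RepAt hT (baseSph G) A)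
    (hHom : ∀ X (τ : X ⟶ T.obj), RepAt hT (baseHom G X) τ) (c : Cell (top T).obj) :
    RepAt (isTerminalTop hT) (varCell G) c := by
  obtain ⟨c, hc⟩ := c
  induction c with
  | var v => exact repAt_var hT (hSph v)
  | coh B hB A hA τ τV ih =>
    have h := repAt_hom hT (free S B.pos) ⟨τ, fun p => ⟨τV p, (hc p).1⟩, fun p => (hc p).2⟩ hSph
      (hHom _) (fun p => ih p (hc p).1)
    refine RepAt.of_mono (isTerminalTop hT) (G := varCell G)
      { app := fun C => TypeCat.ofHom fun σ => Cell.coh B hB A hA σ } h ?_ ?_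
    · intro C σ ρ hσ
      obtain ⟨-, -, h₁, h₂⟩ := RawCell.coh.inj (congrArg Subtype.val hσ)
      exact Hom.ext (eq_of_heq h₁) (funext fun p => Subtype.ext (congrFun (eq_of_heq h₂) p))
    · rintro C ⟨d, hd⟩ h
      have hd' := congrArg Subtype.val h
      cases d with
      | var w =>
        obtain ⟨x, hx⟩ := ((isTerminalTop hT).from C).property.2 w
        cases (congrArg Subtype.val hx).symm.trans hd'
      | coh B' hB' A' hA' ρ ρV =>
        obtain ⟨rfl, h₁, -⟩ := RawCell.coh.inj hd'
        obtain rfl := eq_of_heq h₁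
        exact ⟨⟨ρ, fun p => ⟨ρV p, (hd p).1⟩, fun p => (hd p).2⟩, rfl⟩

theorem repAt_sph (A : Sph (top T).obj) (hSph : ∀ A, RepAt hT (baseSph G) A)
    (hCell : ∀ c : Cell (top T).obj, RepAt (isTerminalTop hT) (varCell G) c) :
    RepAt (isTerminalTop hT) (varSph G) A := by
  have := hasColimits_var (G := G)
  refine RepAt.of_limit (isTerminalTop hT) (P := varSph G) (A := varForget G ⋙ baseSph G)
    (I := ULift Bool) (B := fun _ => varCell G) (S := fun _ => varForget G ⋙ baseSph G)
    { app := fun C => TypeCat.ofHom fun A => Sph.bdry A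
      naturality := fun _ _ _ => rfl }
    (fun i => 
      { app := fun C => TypeCat.ofHom fun A => bif i.down then Sph.fst A else Sph.snd A
        naturality := fun C D σ => by
          ext A
          obtain ⟨_ | _⟩ := i <;> rfl })
    (fun _ => 𝟙 _) (fun _ => varTy G) ?_ ?_ ?_ A (repAt_forget hT _ (hSph _)) (fun i => hCell _)
    (fun v => repAt_forget hT _ (hSph _))
  · rintro C A ⟨_ | _⟩
    · exact (Sph.ty_snd A).symm
    · exact (Sph.ty_fst A).symm
  · intro C A c h
    refine ⟨⟨A, c ⟨true⟩, c ⟨false⟩, (h ⟨true⟩).symm, (h ⟨false⟩).symm⟩, rfl, ?_⟩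
    rintro ⟨_ | _⟩ <;> rfl
  · exact fun C A A' h h' => Sph.ext h (h' ⟨true⟩) (h' ⟨false⟩)

end Limits

end Step

/-! ### Generic elements in all finite dimensions -/

instance (n : ℕ) : (finGenPres.{u} n).IsMultiplicative where
  id_mem C := finGenPres_id n C
  comp_mem σ ρ hσ hρ := finGenPres_comp n σ ρ hσ hρ

/-- The category of `n`-computads and generator-preserving homomorphisms. -/
abbrev FinComputadVar (n : ℕ) : Type (u + 1) := WideSubcategory (finGenPres.{u} n)

/-- The terminal `n`-computad with respect to generator-preserving homomorphisms. -/
def finTop : ∀ n : ℕ, FinComputadVar.{u} n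
  | 0 => ⟨(PUnit : Type u)⟩
  | n + 1 => Step.top (finTop n)

/-- The terminality of `finTop n`. -/
def isTerminalFinTop : ∀ n : ℕ, IsTerminal (finTop.{u} n)
  | 0 => IsTerminal.ofUniqueHom (fun _ => ⟨TypeCat.ofHom fun _ => PUnit.unit, trivial⟩)
      (fun _ _ => WideSubcategory.hom_ext _ rfl)
  | n + 1 => Step.isTerminalTop (isTerminalFinTop n)

instance : (wideSubcategoryInclusion (finGenPres.{u} 0)).Full where
  map_surjective σ := ⟨⟨σ, trivial⟩, rfl⟩

instance : (wideSubcategoryInclusion (finGenPres.{u} 0)).EssSurj where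
  mem_essImage C := ⟨⟨C⟩, ⟨Iso.refl _⟩⟩

instance : (wideSubcategoryInclusion (finGenPres.{u} 0)).IsEquivalence where

instance hasColimits_finComputadVar : ∀ n : ℕ, HasColimitsOfSize.{u, u} (FinComputadVar.{u} n)
  | 0 =>
    have : HasColimitsOfSize.{u, u} (FinComputad.{u} 0) :=
      inferInstanceAs (HasColimitsOfSize.{u, u} (Type u))
    Adjunction.has_colimits_of_equivalence (wideSubcategoryInclusion (finGenPres.{u} 0))
  | n + 1 =>
    have := hasColimits_finComputadVar n
    Step.hasColimits_var (G := finGenPres.{u} n)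

/-- The functor of `n`-cells on generator-preserving homomorphisms. -/
abbrev finVarCell (n : ℕ) : FinComputadVar.{u} n ⥤ Type u :=
  wideSubcategoryInclusion _ ⋙ finCell n

/-- The functor of `n`-spheres on generator-preserving homomorphisms. -/
abbrev finVarSph (n : ℕ) : FinComputadVar.{u} n ⥤ Type u :=
  wideSubcategoryInclusion _ ⋙ finSph n

/-- The functor of homomorphisms out of `X` on generator-preserving homomorphisms. -/
abbrev finVarHom {n : ℕ} (X : FinComputad.{u} n) : FinComputadVar.{u} n ⥤ Type u :=
  wideSubcategoryInclusion _ ⋙ coyoneda.obj (Opposite.op X)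

theorem repAt_finVarHom_zero (X : FinComputad.{u} 0) (τ : X ⟶ (finTop 0).obj) :
    RepAt (isTerminalFinTop 0) (finVarHom X) τ :=
  ⟨⟨X⟩, 𝟙 X, rfl, fun _ c _ =>
    ⟨⟨c, trivial⟩, rfl, fun _ hg => WideSubcategory.hom_ext _ hg⟩⟩

theorem repAt_finVarCell_zero (x : (finVarCell.{u} 0).obj (finTop 0)) :
    RepAt (isTerminalFinTop 0) (finVarCell 0) x :=
  ⟨⟨(PUnit : Type u)⟩, PUnit.unit, rfl, fun _ c _ =>
    ⟨⟨TypeCat.ofHom fun _ => c, trivial⟩, rfl, fun _ hg => WideSubcategory.hom_ext _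
      (ConcreteCategory.hom_ext (C := Type u) _ _ fun _ => hg)⟩⟩

theorem repAt_finVarSph_zero (x : (finVarSph.{u} 0).obj (finTop 0)) :
    RepAt (isTerminalFinTop 0) (finVarSph 0) x :=
  ⟨⟨(ULift Bool : Type u)⟩, (⟨true⟩, ⟨false⟩), rfl, fun _ c _ =>
    ⟨⟨TypeCat.ofHom fun i => bif i.down then c.1 else c.2, trivial⟩, rfl, fun _ hg =>
      WideSubcategory.hom_ext _ (ConcreteCategory.hom_ext (C := Type u) _ _ fun (i : ULift Bool) => by
        obtain ⟨_ | _⟩ := i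
        · exact congrArg Prod.snd hg
        · exact congrArg Prod.fst hg)⟩⟩

theorem repAt_fin : ∀ n : ℕ,
    (∀ c, RepAt (isTerminalFinTop n) (finVarCell.{u} n) c) ∧
    (∀ A, RepAt (isTerminalFinTop n) (finVarSph.{u} n) A) ∧
    ∀ (X : FinComputad.{u} n) (τ : X ⟶ (finTop n).obj),
      RepAt (isTerminalFinTop n) (finVarHom X) τ
  | 0 => ⟨repAt_finVarCell_zero, repAt_finVarSph_zero, repAt_finVarHom_zero⟩
  | n + 1 => by
    obtain ⟨-, hSph, hHom⟩ := repAt_fin n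
    have hCell := Step.repAt_cell (isTerminalFinTop.{u} n) hSph hHom
    exact ⟨hCell, fun A => Step.repAt_sph (isTerminalFinTop.{u} n) A hSph hCell,
      fun X τ => Step.repAt_hom (isTerminalFinTop.{u} n) X τ hSph (hHom _) (fun v => hCell _)⟩

/-! ### Computads without generators above a given dimension -/

section Tower

variable {A : ℕ → Type*} (d : ∀ m, A (m + 1) → A m) (n : ℕ)
  (e : ∀ m, n ≤ m → A m → A (m + 1)) (a : A n)

/-- The sequence with `n`-th term `a`, extended upwards by `e` and downwards by `d`. -/
def tower (m : ℕ) : A m :=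
  if h : n ≤ m then Nat.leRec (motive := fun m _ => A m) a (fun {m} h x => e m h x) h
  else d m (tower (m + 1))
termination_by n - m

theorem tower_self : tower d n e a n = a := by
  rw [tower, dif_pos le_rfl, Nat.leRec_self]

theorem tower_succ {m : ℕ} (h : n ≤ m) : tower d n e a (m + 1) = e m h (tower d n e a m) := by
  rw [tower, dif_pos (Nat.le_succ_of_le h), tower, dif_pos h, Nat.leRec_succ]

theorem map_tower (he : ∀ m h x, d m (e m h x) = x) (m : ℕ) :
    d m (tower d n e a (m + 1)) = tower d n e a m := by
  by_cases h : n ≤ m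
  · rw [tower_succ d n e a h, he]
  · conv_rhs => rw [tower, dif_neg h]

end Tower

namespace Computad

theorem exists_trunc_eq {n : ℕ} (J : FinComputad.{u} n) :
    ∃ K : Computad.{u}, K.trunc n = J ∧
      ∀ m, n ≤ m → IsEmpty (Step.Obj.gen (K.trunc (m + 1))) := by
  let d : ∀ m, FinComputad.{u} (m + 1) → FinComputad.{u} m := fun m => (finForget m).obj
  let e : ∀ m, n ≤ m → FinComputad.{u} m → FinComputad.{u} (m + 1) := fun m _ X =>
    (⟨X, PEmpty, PEmpty.elim⟩ : Step.Obj (computads m))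
  refine ⟨⟨tower d n e J, map_tower d n e J fun _ _ _ => rfl⟩, tower_self d n e J, fun m h => ?_⟩
  change IsEmpty (Step.Obj.gen (tower d n e J (m + 1)))
  rw [tower_succ d n e J h]
  exact inferInstanceAs (IsEmpty PEmpty)

end Computad

namespace ComputadVar

/-- Truncation of generator-preserving homomorphisms of computads. -/
def trunc (n : ℕ) : ComputadVar.{u} ⥤ FinComputadVar.{u} n where
  obj C := ⟨C.obj.trunc n⟩
  map σ := ⟨Computad.Hom.trunc σ.hom n, σ.property n⟩

/-- The comparison between the truncations of a computad in dimensions `n + 1` and `n`. -/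
def forgetTruncIso (C : ComputadVar.{u}) (n : ℕ) :
    (Step.varForget (finGenPres.{u} n)).obj ((trunc (n + 1)).obj C) ≅ (trunc n).obj C :=
  eqToIso (congrArg WideSubcategory.mk (C.obj.forget_trunc n))

theorem eqToHom_hom {n : ℕ} {X Y : FinComputad.{u} n} (h : X = Y) :
    (eqToHom (congrArg (WideSubcategory.mk (_P := finGenPres.{u} n)) h)).hom = eqToHom h := by
  subst h
  rfl

variable {C D : ComputadVar.{u}}

/-- The homomorphism of `n`-computads underlying a homomorphism of `(n + 1)`-computads. -/
def forgetTrunc (n : ℕ) (σ : (trunc (n + 1)).obj C ⟶ (trunc (n + 1)).obj D) :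
    (trunc n).obj C ⟶ (trunc n).obj D :=
  (forgetTruncIso C n).inv ≫ (Step.varForget (finGenPres.{u} n)).map σ ≫ (forgetTruncIso D n).hom

theorem forgetTrunc_eq_iff {n : ℕ} (σ : (trunc (n + 1)).obj C ⟶ (trunc (n + 1)).obj D)
    (τ : (trunc n).obj C ⟶ (trunc n).obj D) :
    forgetTrunc n σ = τ ↔ (finForget n).map σ.hom ≫ eqToHom (D.obj.forget_trunc n) =
      eqToHom (C.obj.forget_trunc n) ≫ τ.hom := by
  rw [forgetTrunc, Iso.inv_comp_eq]
  refine Iff.trans ⟨fun h => congrArg InducedWideCategory.Hom.hom h,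
    fun h => WideSubcategory.hom_ext _ h⟩ (Iff.of_eq ?_)
  exact congrArg₂ (fun a b => (finForget n).map σ.hom ≫ b = a ≫ τ.hom)
    (eqToHom_hom (C.obj.forget_trunc n)) (eqToHom_hom (D.obj.forget_trunc n))

/-- A generator-preserving homomorphism of computads from a compatible sequence of homomorphisms
of `n`-computads. -/
def homMk (σ : ∀ n, (trunc n).obj C ⟶ (trunc n).obj D)
    (h : ∀ n, forgetTrunc n (σ (n + 1)) = σ n) : C ⟶ D :=
  ⟨⟨fun n => (σ n).hom, fun n => (forgetTrunc_eq_iff _ _).1 (h n)⟩, fun n => (σ n).property⟩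

theorem forgetTrunc_trunc_map (σ : C ⟶ D) (n : ℕ) :
    forgetTrunc n ((trunc (n + 1)).map σ) = (trunc n).map σ :=
  (forgetTrunc_eq_iff _ _).2 (Computad.Hom.forget_trunc σ.hom n)

theorem hom_ext {σ τ : C ⟶ D} (h : ∀ n, (trunc n).map σ = (trunc n).map τ) : σ = τ :=
  WideSubcategory.hom_ext _ (Computad.Hom.ext (funext fun n =>
    congrArg InducedWideCategory.Hom.hom (h n)))

/-- The terminal computad. -/
def top : ComputadVar.{u} := ⟨⟨fun n => (finTop n).obj, fun _ => rfl⟩⟩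

/-- The terminality of `top`. -/
def isTerminalTop : IsTerminal top.{u} :=
  IsTerminal.ofUniqueHom
    (fun C => homMk (fun n => (isTerminalFinTop n).from ((trunc n).obj C))
      (fun n => (isTerminalFinTop n).hom_ext _ _))
    (fun _ _ => hom_ext fun n => (isTerminalFinTop n).hom_ext _ _)

theorem forgetTrunc_bijective {n : ℕ} (hC : IsEmpty (Step.Obj.gen (C.obj.trunc (n + 1)))) :
    Function.Bijective (forgetTrunc (C := C) (D := D) n) := by
  constructor
  · intro σ τ h
    rw [forgetTrunc, forgetTrunc, cancel_epi, cancel_mono] at h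
    exact Step.var_hom_ext (congrArg InducedWideCategory.Hom.hom h) (fun v => hC.elim v)
  · intro σ
    let b := (forgetTruncIso C n).hom ≫ σ ≫ (forgetTruncIso D n).inv
    let τ : (trunc (n + 1)).obj C ⟶ (trunc (n + 1)).obj D :=
      Step.homMk (S := computads n) (G := finGenPres n) (C := (trunc (n + 1)).obj C)
        (D := (trunc (n + 1)).obj D) b.hom b.property (fun v => hC.elim v)
        (fun v => hC.elim v)
    have hτ : (Step.varForget (finGenPres.{u} n)).map τ = b := rfl
    refine ⟨τ, ?_⟩
    rw [forgetTrunc, hτ]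
    simp [b]

theorem existsUnique_trunc_map_eq {n : ℕ}
    (hC : ∀ m, n ≤ m → IsEmpty (Step.Obj.gen (C.obj.trunc (m + 1))))
    (σ : (trunc n).obj C ⟶ (trunc n).obj D) : ∃! g : C ⟶ D, (trunc n).map g = σ := by
  have hbij : ∀ m, n ≤ m → Function.Bijective (forgetTrunc (C := C) (D := D) m) := fun m h =>
    forgetTrunc_bijective (hC m h)
  choose e he using fun m h => (hbij m h).2
  refine ⟨homMk _ (map_tower forgetTrunc n e σ he), tower_self forgetTrunc n e σ, fun g hg => ?_⟩
  refine hom_ext fun m => ?_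
  change (trunc m).map g = tower forgetTrunc n e σ m
  have hdown : ∀ k m, m + k = n → (trunc m).map g = tower forgetTrunc n e σ m := by
    intro k
    induction k with
    | zero =>
      rintro m rfl
      exact hg.trans (tower_self forgetTrunc _ e σ).symm
    | succ k ih =>
      intro m h
      rw [← map_tower forgetTrunc n e σ he, ← ih (m + 1) (by omega), forgetTrunc_trunc_map]
  rcases le_total m n with h | h
  · obtain ⟨k, hk⟩ := Nat.exists_eq_add_of_le h
    exact hdown k m hk.symm
  · induction m, h using Nat.le_induction with
    | base => exact hdown 0 n rfl
    | succ m h ih =>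
      apply (hbij m h).1
      rw [map_tower forgetTrunc n e σ he, forgetTrunc_trunc_map, ih]

theorem repAt_trunc {n : ℕ} (F : FinComputadVar.{u} n ⥤ Type u) {x : F.obj (finTop n)}
    (h : RepAt (isTerminalFinTop n) F x) : RepAt isTerminalTop (trunc n ⋙ F) x := by
  have hfrom : ∀ C : ComputadVar.{u}, (trunc n).map (isTerminalTop.from C) =
      (isTerminalFinTop n).from ((trunc n).obj C) := fun C => (isTerminalFinTop n).hom_ext _ _
  obtain ⟨⟨J⟩, j, hj, hu⟩ := h
  obtain ⟨K, rfl, hK⟩ := Computad.exists_trunc_eq J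
  refine ⟨⟨K⟩, j, ?_, fun C c hc => ?_⟩
  · rw [Functor.comp_map, hfrom]
    exact hj
  · rw [Functor.comp_map, hfrom] at hc
    obtain ⟨σ, hσ, hσu⟩ := hu _ c hc
    obtain ⟨g, hg, hgu⟩ := existsUnique_trunc_map_eq (C := ⟨K⟩) hK σ
    refine ⟨g, ?_, fun g' hg' => hgu g' (hσu _ hg')⟩
    simp only at hg hσ
    rw [← hσ, ← hg]
    rfl

end ComputadVar

end OmegaComputad

theorem mainTheorem2 :
    HasTerminal OmegaComputad.ComputadVar.{u} ∧
    ∀ (T : OmegaComputad.ComputadVar.{u}) (hT : IsTerminal T),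
      (∃ (J : (OmegaComputad.ComputadVar.cell.obj T).El ⥤ OmegaComputad.ComputadVar.{u})
          (α : OmegaComputad.ComputadVar.cell ≅
            (OmegaComputad.ComputadVar.cell.obj T).familial J),
        ∀ (C : OmegaComputad.ComputadVar.{u}) (n : ℕ)
          (c : (OmegaComputad.ComputadVar.cell.obj C).cells n),
          (OmegaComputad.GlobularSet.Hom.map (α.hom.app C) n c).1 =
            OmegaComputad.GlobularSet.Hom.map
              (OmegaComputad.ComputadVar.cell.map (hT.from C)) n c) ∧
      (∃ (J : (OmegaComputad.ComputadVar.sph.obj T).El ⥤ OmegaComputad.ComputadVar.{u})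
          (α : OmegaComputad.ComputadVar.sph ≅
            (OmegaComputad.ComputadVar.sph.obj T).familial J),
        ∀ (C : OmegaComputad.ComputadVar.{u}) (n : ℕ)
          (A : (OmegaComputad.ComputadVar.sph.obj C).cells n),
          (OmegaComputad.GlobularSet.Hom.map (α.hom.app C) n A).1 =
            OmegaComputad.GlobularSet.Hom.map
              (OmegaComputad.ComputadVar.sph.map (hT.from C)) n A) := by
  refine ⟨OmegaComputad.ComputadVar.isTerminalTop.hasTerminal, fun T hT => ⟨?_, ?_⟩⟩
  · exact OmegaComputad.GlobularSet.exists_familial hT _ fun n =>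
      OmegaComputad.RepAt.of_terminal OmegaComputad.ComputadVar.isTerminalTop hT fun c =>
        OmegaComputad.ComputadVar.repAt_trunc (OmegaComputad.finVarCell n)
          ((OmegaComputad.repAt_fin n).1 c)
  · exact OmegaComputad.GlobularSet.exists_familial hT _ fun n =>
      OmegaComputad.RepAt.of_terminal OmegaComputad.ComputadVar.isTerminalTop hT fun A =>
        OmegaComputad.ComputadVar.repAt_trunc (OmegaComputad.finVarSph n)
          ((OmegaComputad.repAt_fin n).2.1 A)
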